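/- Let $d,m\in\mathbb N$, $\lambda>0$, $\gamma>0$, let $U\subset\mathbb R^m$ be convex and compact, let $f:\mathbb R^d\times U\to\mathbb R^d$ be continuous, and let $\ell(x,u)=\ell_1(x)+\gamma\sum_{k=1}^m|u^k|$, where $\ell_1:\mathbb R^d\to\mathbb R$ is nonnegative and strictly convex. For $x\in\mathbb R^d$, call $(y,u)$ admissible for $x$ if $u\in L^\infty(0,\infty;U)$ (that is, $u$ is measurable and essentially bounded with $u(s)\in U$ for a.e. $s>0$) and $y:[0,\infty)\to\mathbb R^d$ is absolutely continuous on every $[0,T]$, $T>0$, with $\dot y(s)=f(y(s),u(s))$ for a.e. $s>0$ and $y(0)=x$. The cost of an admissible pair is $\int_0^\infty e^{-\lambda s}\ell(y(s),u(s))\,ds\in[0,\infty]$. Assume: (H1) there is $L>0$ such that $\|f(x_1,u)-f(x_2,u)\|_2\le L\|x_1-x_2\|_2$ for all $x_1,x_2\in\mathbb R^d$ and $u\in U$; (H2) for every $x\in\mathbb R^d$ there is an admissible pair $(y^*,u^*)$ for $x$ with finite cost; (H3) for every $x\in\mathbb R^d$ the set $\{(f(x,u),\xi):\ u\in U,\ \xi\ge\ell(x,u)\}\subset\mathbb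 R^d\times\mathbb R$ is convex. Then for every $x\in\mathbb R^d$ the problem of minimizing $\int_0^\infty e^{-\lambda s}\ell(y(s),u(s))\,ds$ over all admissible pairs $(y,u)$ for $x$ has an optimal control: there is $\bar u\in L^\infty(0,\infty;U)$, with a trajectory $\bar y$ such that $(\bar y,\bar u)$ is admissible for $x$ and the cost of $(\bar y,\bar u)$ is at most the cost of every admissible pair for $x$. -/

import Mathlib

open MeasureTheory Set

namespace SparseControl

/-- `ℝ^k` with its Euclidean norm. -/
abbrev Vec (k : ℕ) : Type := EuclideanSpace ℝ (Fin k)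

/-- The running cost `ℓ(x,u) = ℓ₁(x) + γ ‖u‖₁`, where `‖u‖₁ = ∑ₖ |uᵏ|`. -/
noncomputable def runningCost {d m : ℕ} (γ : ℝ) (ℓ₁ : Vec d → ℝ) (x : Vec d) (u : Vec m) : ℝ :=
  ℓ₁ x + γ * ∑ k, |u k|

/-- `u ∈ L^∞(0,∞;U)`: `u` is an essentially bounded (strongly) measurable function on `(0,∞)`
taking values in `U` almost everywhere. -/
def IsControl {m : ℕ} (U : Set (Vec m)) (u : ℝ → Vec m) : Prop :=
  MemLp u ⊤ (volume.restrict (Ioi (0 : ℝ))) ∧ ∀ᵐ s ∂(volume.restrict (Ioi (0 : ℝ))), u s ∈ U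

/-- `y` is a (Carathéodory) trajectory on `[0,∞)` of `ẏ(s) = f(y(s),u(s))` for a.e. `s > 0`,
`y(0) = x`: it is absolutely continuous on every `[0,T]`, solves the equation almost everywhere,
and has the initial value `x`. -/
def IsTrajectory {d m : ℕ} (f : Vec d → Vec m → Vec d) (x : Vec d)
    (u : ℝ → Vec m) (y : ℝ → Vec d) : Prop :=
  (∀ T : ℝ, 0 < T → AbsolutelyContinuousOnInterval y 0 T) ∧
  (∀ᵐ s ∂(volume.restrict (Ioi (0 : ℝ))), HasDerivAt y (f (y s) (u s)) s) ∧
  y 0 = x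

/-- `(y,u)` is an admissible pair for the initial point `x`. -/
def IsAdmissible {d m : ℕ} (U : Set (Vec m)) (f : Vec d → Vec m → Vec d) (x : Vec d)
    (y : ℝ → Vec d) (u : ℝ → Vec m) : Prop :=
  IsControl U u ∧ IsTrajectory f x u y

/-- The discounted cost `∫₀^∞ e^{-λ s} ℓ(y(s),u(s)) ds` as an element of `[0,∞]`
(it is used for nonnegative `ℓ` only). -/
noncomputable def discountedCost {d m : ℕ} (lam : ℝ) (ℓ : Vec d → Vec m → ℝ)
    (y : ℝ → Vec d) (u : ℝ → Vec m) : ENNReal :=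
  ∫⁻ s in Ioi (0 : ℝ), ENNReal.ofReal (Real.exp (-lam * s) * ℓ (y s) (u s))

/-- `u` is an optimal control (a minimizer) for the initial point `x`: it is a control with a
trajectory `y` whose cost does not exceed the cost of any admissible pair for `x`. -/
def IsOptimalControl {d m : ℕ} (lam : ℝ) (U : Set (Vec m)) (f : Vec d → Vec m → Vec d)
    (ℓ : Vec d → Vec m → ℝ) (x : Vec d) (u : ℝ → Vec m) : Prop :=
  ∃ y : ℝ → Vec d, IsAdmissible U f x y u ∧
    ∀ (z : ℝ → Vec d) (w : ℝ → Vec m), IsAdmissible U f x z w →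
      discountedCost lam ℓ y u ≤ discountedCost lam ℓ z w

end SparseControl

/-!
Existence of an optimal control by the direct method. Take a minimizing sequence of admissible pairs
`(y k, u k)` for `x`.

*Compactness.* The dynamics grow at most linearly, so Grönwall's inequality bounds all trajectories,
hence their derivatives and running costs, on each bounded interval
(`exists_uniform_bound`, `exists_uniform_deriv_bound`, `exists_uniform_cost_bound`). The trajectories
are equi-Lipschitz there, and a subsequence converges pointwise
(`exists_subseq_tendsto_of_lipschitzOnWith`).

*Convexification.* The controls need not converge in any useful sense. Instead of weak compactness
and Mazur's lemma, the proof uses that a bounded sequence in a Hilbert space has convex combinations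
of its tails that converge in norm (`exists_isForwardConvex_tendsto`). Applied in an `L²` space to
the pairs of velocity and running cost, rescaled to be bounded, this yields almost everywhere limits
`(v, ξ)` (`exists_isForwardConvex_ae_tendsto`). The same combinations of a convergent sequence keep
its limit, so the limit trajectory has derivative `v`, and, since the epigraph of the velocity set
at each state is convex and closed, `(v s, ξ s)` lies in the epigraph at the limit state
(`exists_control_of_tendsto`).

*Selection and cost.* A measurable selection theorem for closed relations with compact fibres
(`exists_measurable_selection`) provides a control with velocity `v` and running cost at most `ξ`
(`exists_isAdmissible_of_velocityCostRel`), and Fatou's lemma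
(`IsForwardConvex.lintegral_ofReal_le`) bounds the discounted integral of `ξ` by the limit of the
costs.
-/

open Filter Topology

namespace SparseControl

/-! ### Forward convex combinations -/

/-- `c n` are the weights of a convex combination of the terms with index at least `n` of a
sequence. -/
def IsForwardConvex (c : ℕ → ℕ →₀ ℝ) : Prop :=
  ∀ n, (∀ k, 0 ≤ c n k) ∧ ∑ k ∈ (c n).support, c n k = 1 ∧ ∀ k ∈ (c n).support, n ≤ k

theorem IsForwardConvex.comp_strictMono {c : ℕ → ℕ →₀ ℝ} (hc : IsForwardConvex c) {φ : ℕ → ℕ}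
    (hφ : StrictMono φ) : IsForwardConvex (c ∘ φ) := fun n =>
  ⟨(hc (φ n)).1, (hc (φ n)).2.1, fun k hk => (hφ.id_le n).trans ((hc (φ n)).2.2 k hk)⟩

/-- Forward convex combinations of a convergent sequence have the same limit. -/
theorem IsForwardConvex.tendsto_sum {E : Type*} [NormedAddCommGroup E] [NormedSpace ℝ E]
    {c : ℕ → ℕ →₀ ℝ} (hc : IsForwardConvex c) {a : ℕ → E} {b : E} (ha : Tendsto a atTop (𝓝 b)) :
    Tendsto (fun n => ∑ k ∈ (c n).support, c n k • a k) atTop (𝓝 b) := by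
  rw [Metric.tendsto_atTop] at ha ⊢
  intro ε hε
  obtain ⟨N, hN⟩ := ha ε hε
  refine ⟨N, fun n hn => ?_⟩
  obtain ⟨h0, h1, h2⟩ := hc n
  exact (convex_ball b ε).sum_mem (fun k _ => h0 k) h1 fun k hk => hN k (hn.trans (h2 k hk))

theorem exists_weights_of_mem_convexHull_tail {E : Type*} [AddCommGroup E] [Module ℝ E]
    {x : ℕ → E} {n : ℕ} {z : E} (hz : z ∈ convexHull ℝ (x '' Ici n)) :
    ∃ c : ℕ →₀ ℝ, ((∀ k, 0 ≤ c k) ∧ ∑ k ∈ c.support, c k = 1 ∧ ∀ k ∈ c.support, n ≤ k) ∧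
      ∑ k ∈ c.support, c k • x k = z := by
  obtain ⟨ι, _, w, p, hw0, hw1, hp, rfl⟩ := mem_convexHull_iff_exists_fintype.1 hz
  choose κ hκ hκp using hp
  let c : ℕ →₀ ℝ := ∑ i, Finsupp.single (κ i) (w i)
  have hlin : ∀ {V : Type _} [AddCommGroup V] [Module ℝ V] (q : ℕ → V),
      ∑ k ∈ c.support, c k • q k = ∑ i, w i • q (κ i) := by
    intro V _ _ q
    have : Finsupp.linearCombination ℝ q c = ∑ i, w i • q (κ i) := by
      simp [c, map_sum]
    rw [← this, Finsupp.linearCombination_apply, Finsupp.sum]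
  have hck : ∀ k, c k = ∑ i, if κ i = k then w i else 0 := by
    intro k
    simp [c, Finsupp.finsetSum_apply, Finsupp.single_apply]
  refine ⟨c, ⟨fun k => ?_, ?_, fun k hk => ?_⟩, ?_⟩
  · rw [hck]
    exact Finset.sum_nonneg fun i _ => by split_ifs; exacts [hw0 i, le_rfl]
  · have : Finsupp.linearCombination ℝ (fun _ : ℕ => (1 : ℝ)) c = ∑ i, w i := by
      simp [c, map_sum]
    rw [Finsupp.linearCombination_apply, Finsupp.sum] at this
    simpa [hw1] using this
  · by_contra hlt
    refine (Finsupp.mem_support_iff.1 hk) ?_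
    rw [hck]
    refine Finset.sum_eq_zero fun i _ => ?_
    rw [if_neg]
    rintro rfl
    exact hlt (hκ i)
  · rw [hlin]
    simp [hκp]

/-- A bounded sequence in a Hilbert space has norm convergent forward convex combinations: nearly
norm-minimal elements of the convex hulls of its tails form a Cauchy sequence, by the
parallelogram law. -/
theorem exists_isForwardConvex_tendsto {H : Type*} [NormedAddCommGroup H] [InnerProductSpace ℝ H]
    [CompleteSpace H] {x : ℕ → H} {C : ℝ} (hx : ∀ n, ‖x n‖ ≤ C) :
    ∃ c : ℕ → ℕ →₀ ℝ, IsForwardConvex c ∧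
      ∃ z, Tendsto (fun n => ∑ k ∈ (c n).support, c n k • x k) atTop (𝓝 z) := by
  let K : ℕ → Set H := fun n => convexHull ℝ (x '' Ici n)
  -- `δ n` is the distance of the `n`-th tail hull from the origin, nondecreasing and bounded
  have hKne : ∀ n, (K n).Nonempty := fun n =>
    ⟨x n, subset_convexHull ℝ _ ⟨n, self_mem_Ici, rfl⟩⟩
  have hKanti : Antitone K := fun i j hij =>
    convexHull_mono (image_mono (Ici_subset_Ici.2 hij))
  have hKbdd : ∀ n, ∀ z ∈ K n, ‖z‖ ≤ C := by
    intro n z hz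
    have : K n ⊆ Metric.closedBall 0 C := by
      refine convexHull_min ?_ (convex_closedBall 0 C)
      rintro _ ⟨k, _, rfl⟩
      simpa using hx k
    simpa using this hz
  let δ : ℕ → ℝ := fun n => sInf ((fun z => ‖z‖) '' K n)
  have hbelow : ∀ n, BddBelow ((fun z => ‖z‖) '' K n) := fun n =>
    ⟨0, by rintro _ ⟨z, _, rfl⟩; exact norm_nonneg z⟩
  have hδle : ∀ n, ∀ z ∈ K n, δ n ≤ ‖z‖ := fun n z hz => csInf_le (hbelow n) ⟨z, hz, rfl⟩
  have hδ0 : ∀ n, 0 ≤ δ n := fun n =>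
    le_csInf ((hKne n).image _) (by rintro _ ⟨z, _, rfl⟩; exact norm_nonneg z)
  have hδmono : Monotone δ := fun i j hij =>
    csInf_le_csInf (hbelow i) ((hKne j).image _) (image_mono (hKanti hij))
  have hδC : ∀ n, δ n ≤ C := fun n => by
    obtain ⟨z, hz⟩ := hKne n
    exact (hδle n z hz).trans (hKbdd n z hz)
  have hδlim : Tendsto δ atTop (𝓝 (⨆ n, δ n)) :=
    tendsto_atTop_ciSup hδmono ⟨C, by rintro _ ⟨n, rfl⟩; exact hδC n⟩
  have hex : ∀ n : ℕ, ∃ z ∈ K n, ‖z‖ < δ n + 1 / ((n : ℝ) + 1) := by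
    intro n
    obtain ⟨_, ⟨z, hz, rfl⟩, hlt⟩ := exists_lt_of_csInf_lt ((hKne n).image (fun z => ‖z‖))
      (lt_add_of_pos_right (δ n) (Nat.one_div_pos_of_nat (n := n)))
    exact ⟨z, hz, hlt⟩
  choose z hzK hzlt using hex
  choose c hc hcz using fun n => exists_weights_of_mem_convexHull_tail (hzK n)
  refine ⟨c, hc, ?_⟩
  simp_rw [hcz]
  apply cauchySeq_tendsto_of_complete
  set b : ℕ → ℝ := fun n => 2 * (2 * (((⨆ i, δ i) + 1 / ((n : ℝ) + 1)) ^ 2 - δ n ^ 2)) with hb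
  have hsup : ∀ n, δ n ≤ ⨆ i, δ i :=
    fun n => le_ciSup ⟨C, by rintro _ ⟨n, rfl⟩; exact hδC n⟩ n
  have hpar : ∀ N n m : ℕ, N ≤ n → N ≤ m → ‖z n - z m‖ ^ 2 ≤ b N := by
    intro N n m hn hm
    have hup : ∀ k, N ≤ k → ‖z k‖ ^ 2 ≤ ((⨆ i, δ i) + 1 / ((N : ℝ) + 1)) ^ 2 := by
      intro k hk
      have h1 : 1 / ((k : ℝ) + 1) ≤ 1 / ((N : ℝ) + 1) := Nat.one_div_le_one_div hk
      have := hzlt k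
      have := hsup k
      exact pow_le_pow_left₀ (norm_nonneg _) (by linarith) 2
    -- the midpoint lies in the hull of the `N`-th tail, so its norm is at least `δ N`
    have hmid : (1 / 2 : ℝ) • z n + (1 / 2 : ℝ) • z m ∈ K N :=
      (convex_convexHull ℝ _) (hKanti hn (hzK n)) (hKanti hm (hzK m)) (by norm_num) (by norm_num)
        (by norm_num)
    have h2 : δ N ≤ ‖z n + z m‖ / 2 := by
      have := hδle N _ hmid
      rw [← smul_add, norm_smul] at this
      norm_num at this
      linarith
    have h3 := parallelogram_law_with_norm ℝ (z n) (z m)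
    have h4 := pow_le_pow_left₀ (hδ0 N) h2 2
    have := hup n hn
    have := hup m hm
    simp only [hb]
    nlinarith
  have hb0 : Tendsto (fun n => Real.sqrt (b n)) atTop (𝓝 0) := by
    have : Tendsto b atTop (𝓝 (2 * (2 * (((⨆ i, δ i) + 0) ^ 2 - (⨆ i, δ i) ^ 2)))) :=
      ((((tendsto_const_nhds.add tendsto_one_div_add_atTop_nhds_zero_nat).pow 2).sub
        (hδlim.pow 2)).const_mul 2).const_mul 2
    have h := (Real.continuous_sqrt.tendsto _).comp this
    simpa [Function.comp_def] using h
  refine cauchySeq_of_le_tendsto_0 (fun n => Real.sqrt (b n)) (fun n m N hn hm => ?_) hb0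
  rw [dist_eq_norm]
  exact Real.le_sqrt_of_sq_le (hpar N n m hn hm)

/-- Uniformly bounded functions on a finite measure space have forward convex combinations that
converge almost everywhere. -/
theorem exists_isForwardConvex_ae_tendsto_of_bounded {Ω F : Type*} [MeasurableSpace Ω]
    {μ : Measure Ω} [IsFiniteMeasure μ] [NormedAddCommGroup F] [InnerProductSpace ℝ F]
    [CompleteSpace F] {h : ℕ → Ω → F} (hm : ∀ k, AEStronglyMeasurable (h k) μ) {C : ℝ}
    (hC : ∀ k, ∀ᵐ ω ∂μ, ‖h k ω‖ ≤ C) :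
    ∃ c : ℕ → ℕ →₀ ℝ, IsForwardConvex c ∧ ∃ g : Ω → F, StronglyMeasurable g ∧
      ∀ᵐ ω ∂μ, Tendsto (fun n => ∑ k ∈ (c n).support, c n k • h k ω) atTop (𝓝 (g ω)) := by
  have hL : ∀ k, MemLp (h k) 2 μ := fun k => MemLp.of_bound (hm k) C (hC k)
  let X : ℕ → Lp F 2 μ := fun k => (hL k).toLp
  have hX : ∀ k, ‖X k‖ ≤ (μ univ).toNNReal ^ ((2 : ENNReal).toReal)⁻¹ * max C 0 := fun k => by
    refine Lp.norm_le_of_ae_bound (le_max_right _ _) ?_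
    filter_upwards [(hL k).coeFn_toLp, hC k] with ω h1 h2
    rw [h1]
    exact h2.trans (le_max_left _ _)
  obtain ⟨c, hc, Z, hZ⟩ := exists_isForwardConvex_tendsto hX
  obtain ⟨φ, hφ, hφt⟩ := (tendstoInMeasure_of_tendsto_Lp hZ).exists_seq_tendsto_ae
  refine ⟨c ∘ φ, hc.comp_strictMono hφ, Z, Lp.stronglyMeasurable Z, ?_⟩
  have hcoe : ∀ n, ∀ᵐ ω ∂μ, (∑ k ∈ (c n).support, c n k • X k : Lp F 2 μ) ω
      = ∑ k ∈ (c n).support, c n k • h k ω := by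
    intro n
    generalize (c n).support = s
    induction s using Finset.induction_on with
    | empty => filter_upwards [Lp.coeFn_zero F 2 μ] with ω h1 using by simpa using h1
    | insert a s ha ih =>
      simp only [Finset.sum_insert ha]
      filter_upwards [ih, Lp.coeFn_add (c n a • X a) (∑ k ∈ s, c n k • X k),
        Lp.coeFn_smul (c n a) (X a), (hL a).coeFn_toLp] with ω h1 h2 h3 h4
      rw [h2, Pi.add_apply, h1, h3, Pi.smul_apply, h4]
  filter_upwards [hφt, ae_all_iff.2 hcoe] with ω h1 h2
  simpa only [h2, Function.comp_apply] using h1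

/-- Pointwise bounded functions have forward convex combinations that converge almost everywhere:
after division by the bound `G` and passage to an equivalent finite measure they are uniformly
bounded, and convex combinations commute with the pointwise rescaling. -/
theorem exists_isForwardConvex_ae_tendsto {Ω F : Type*} [MeasurableSpace Ω]
    {μ : Measure Ω} [SFinite μ] [NormedAddCommGroup F] [InnerProductSpace ℝ F]
    [CompleteSpace F] {h : ℕ → Ω → F} (hm : ∀ k, AEStronglyMeasurable (h k) μ) {G : Ω → ℝ}
    (hG : Measurable G) (hG0 : ∀ ω, 0 < G ω) (hhG : ∀ k, ∀ᵐ ω ∂μ, ‖h k ω‖ ≤ G ω) :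
    ∃ c : ℕ → ℕ →₀ ℝ, IsForwardConvex c ∧ ∃ g : Ω → F, StronglyMeasurable g ∧
      ∀ᵐ ω ∂μ, Tendsto (fun n => ∑ k ∈ (c n).support, c n k • h k ω) atTop (𝓝 (g ω)) := by
  have hm' : ∀ k, AEStronglyMeasurable (fun ω => (G ω)⁻¹ • h k ω) μ.toFinite := fun k =>
    (hG.inv.aestronglyMeasurable.smul (hm k)).mono_ac
      (toFinite_absolutelyContinuous μ)
  obtain ⟨c, hc, g, hg, hcg⟩ := exists_isForwardConvex_ae_tendsto_of_bounded (C := 1) hm' (by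
    intro k
    rw [ae_toFinite]
    filter_upwards [hhG k] with ω hω
    rw [norm_smul, norm_inv, Real.norm_of_nonneg (hG0 ω).le, inv_mul_le_iff₀ (hG0 ω)]
    simpa using hω)
  rw [ae_toFinite] at hcg
  refine ⟨c, hc, fun ω => G ω • g ω, hG.stronglyMeasurable.smul hg, ?_⟩
  filter_upwards [hcg] with ω hω
  convert! hω.const_smul (G ω) using 2 with n
  rw [Finset.smul_sum]
  refine Finset.sum_congr rfl fun k _ => ?_
  rw [smul_comm, smul_inv_smul₀ (hG0 ω).ne']

/-! ### Measurable selection -/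

/-- Selection of the least element of the fibres of a closed subset of `P × C` for a compact set `C`
of reals. -/
theorem exists_measurable_selection_of_isCompact_real {P : Type*} [TopologicalSpace P]
    [MeasurableSpace P] [OpensMeasurableSpace P] {C : Set ℝ} (hC : IsCompact C)
    {F : Set (P × C)} (hF : IsClosed F) :
    ∃ τ : P → ℝ, Measurable τ ∧ ∀ p, (∃ k, (p, k) ∈ F) → ∃ k : C, (k : ℝ) = τ p ∧ (p, k) ∈ F := by
  classical
  have : CompactSpace C := isCompact_iff_compactSpace.1 hC
  let S : P → Set C := fun p => {k | (p, k) ∈ F}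
  have hmin : ∀ p, ∃ t : ℝ, ((S p).Nonempty → ∃ k ∈ S p, (k : ℝ) = t ∧ ∀ k' ∈ S p, t ≤ k') ∧
      (¬ (S p).Nonempty → t = 0) := by
    intro p
    by_cases hp : (S p).Nonempty
    · obtain ⟨k, hk, hle⟩ :=
        (hF.preimage (Continuous.prodMk_right p)).isCompact.exists_isLeast hp
      exact ⟨k, fun _ => ⟨k, hk, rfl, fun k' hk' => hle hk'⟩, fun h => (h hp).elim⟩
    · exact ⟨0, fun h => (hp h).elim, fun _ => rfl⟩
  choose τ hτ hτ0 using hmin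
  -- the projection of a closed set along the compact factor is closed
  have hproj : ∀ D : Set C, IsClosed D → IsClosed {p | (S p ∩ D).Nonempty} := by
    intro D hD
    have h := isClosedMap_fst_of_compactSpace (X := P) (Y := C) _
      (hF.inter (hD.preimage continuous_snd))
    convert! h using 1
    ext p
    simp [S, Set.Nonempty]
  refine ⟨τ, measurable_of_Iic fun a => ?_, fun p hp => ?_⟩
  · have h1 := (hproj univ isClosed_univ).measurableSet
    simp only [inter_univ] at h1
    have h2 := (hproj {k | (k : ℝ) ≤ a}
      (isClosed_le continuous_subtype_val continuous_const)).measurableSet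
    -- the value `0` of `τ` at empty fibres accounts for the second set
    have : τ ⁻¹' Iic a = {p | (S p ∩ {k | (k : ℝ) ≤ a}).Nonempty} ∪
        ({p | (S p).Nonempty}ᶜ ∩ {_p | (0 : ℝ) ≤ a}) := by
      ext p
      by_cases hp : (S p).Nonempty
      · obtain ⟨κ, hκ, hκτ, hmin⟩ := hτ p hp
        simp only [mem_preimage, mem_Iic, mem_union, mem_inter_iff, mem_compl_iff,
          mem_ofPred_eq, hp, not_true, false_and, or_false]
        exact ⟨fun h => ⟨κ, hκ, hκτ.le.trans h⟩, fun ⟨k, hk, hka⟩ => (hmin k hk).trans hka⟩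
      · have : ¬ (S p ∩ {k | (k : ℝ) ≤ a}).Nonempty := fun h => hp (h.mono inter_subset_left)
        simp [hτ0 p hp, hp, this]
    rw [this]
    exact h2.union (h1.compl.inter (MeasurableSet.const _))
  · obtain ⟨k, hk, hkτ, -⟩ := hτ p hp
    exact ⟨k, hkτ, hk⟩

/-- Measurable selection for a closed relation with values in a compact metric space: the space is
a continuous image of the Cantor set, which reduces the claim to the choice of least elements. -/
theorem exists_measurable_selection {P K : Type*} [TopologicalSpace P]
    [MeasurableSpace P] [OpensMeasurableSpace P] [MetricSpace K] [CompactSpace K] [Nonempty K]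
    [MeasurableSpace K] [BorelSpace K] {F : Set (P × K)} (hF : IsClosed F) :
    ∃ σ : P → K, Measurable σ ∧ ∀ p, (∃ k, (p, k) ∈ F) → (p, σ p) ∈ F := by
  classical
  obtain ⟨q, hq, hqs⟩ := exists_nat_bool_continuous_surjective_of_compact K
  let r : cantorSet → K := q ∘ cantorSetHomeomorphNatToBool
  have hr : Continuous r := hq.comp cantorSetHomeomorphNatToBool.continuous
  have hrs : Function.Surjective r := hqs.comp cantorSetHomeomorphNatToBool.surjective
  obtain ⟨τ, hτ, hτF⟩ := exists_measurable_selection_of_isCompact_real isCompact_cantorSet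
    (hF.preimage (continuous_id.prodMap hr))
  have hms : MeasurableSet cantorSet := isClosed_cantorSet.measurableSet
  let ρ : ℝ → K := fun t => if h : t ∈ cantorSet then r ⟨t, h⟩ else Classical.arbitrary K
  have hρ : Measurable ρ := Measurable.dite (hr.measurable) measurable_const hms
  refine ⟨ρ ∘ τ, hρ.comp hτ, fun p ⟨k, hk⟩ => ?_⟩
  obtain ⟨t, rfl⟩ := hrs k
  obtain ⟨t', ht', htF⟩ := hτF p ⟨t, hk⟩
  have : ρ (τ p) = r t' := by simp [ρ, ← ht']
  simpa [this] using htF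

/-! ### Absolutely continuous functions, compactness and Grönwall's inequality -/

section

variable {E : Type*} [NormedAddCommGroup E]

theorem intervalIntegrable_of_ae_norm_le {g : ℝ → E} {a b C : ℝ} (hab : a ≤ b)
    (hg : AEStronglyMeasurable g (volume.restrict (Ioc a b)))
    (hC : ∀ᵐ s ∂volume.restrict (Ioc a b), ‖g s‖ ≤ C) : IntervalIntegrable g volume a b := by
  rw [intervalIntegrable_iff_integrableOn_Ioc_of_le hab]
  exact ⟨hg, HasFiniteIntegral.of_bounded hC⟩

/-- A sequence of functions on `[0, ∞)` that are equi-Lipschitz on bounded intervals and have the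
same initial value has a pointwise convergent subsequence: the values at rational points lie in a
countable product of compact sets. -/
theorem exists_subseq_tendsto_of_lipschitzOnWith [ProperSpace E] {y : ℕ → ℝ → E} {x : E}
    {Λ : ℕ → NNReal} (h0 : ∀ k, y k 0 = x)
    (hΛ : ∀ (T : ℕ) k, LipschitzOnWith (Λ T) (y k) (Icc 0 (T : ℝ))) :
    ∃ φ : ℕ → ℕ, StrictMono φ ∧ ∃ z : ℝ → E, ∀ t, 0 ≤ t →
      Tendsto (fun n => y (φ n) t) atTop (𝓝 (z t)) := by
  let Y : ℕ → (ℚ → E) := fun k q => y k |(q : ℝ)|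
  let B : Set (ℚ → E) := univ.pi fun q : ℚ =>
    Metric.closedBall x (Λ ⌈|(q : ℝ)|⌉₊ * |(q : ℝ)|)
  have hB : IsCompact B := isCompact_univ_pi fun q => isCompact_closedBall _ _
  have hYB : ∀ k, Y k ∈ B := by
    intro k q _
    have := (hΛ ⌈|(q : ℝ)|⌉₊ k).dist_le_mul |(q : ℝ)| ⟨abs_nonneg _, Nat.le_ceil _⟩ 0
      ⟨le_rfl, Nat.cast_nonneg _⟩
    simpa [h0] using this
  obtain ⟨Z, -, φ, hφ, hZ⟩ := hB.isSeqCompact hYB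
  rw [tendsto_pi_nhds] at hZ
  have hlim : ∀ t, 0 ≤ t → ∃ z, Tendsto (fun n => y (φ n) t) atTop (𝓝 z) := by
    intro t ht
    apply cauchySeq_tendsto_of_complete
    rw [Metric.cauchySeq_iff]
    intro ε hε
    obtain ⟨T, hT⟩ := exists_nat_ge (t + 1)
    set K : ℝ := (Λ T : ℝ)
    have hK0 : 0 ≤ K := (Λ T).coe_nonneg
    obtain ⟨q, hq1, hq2⟩ := exists_rat_btwn
      (lt_add_of_pos_right t (lt_min one_pos (show 0 < ε / (3 * (K + 1)) by positivity)))
    have hq0 : (0 : ℝ) ≤ q := ht.trans hq1.le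
    have hqT : (q : ℝ) ≤ T := by linarith [min_le_left 1 (ε / (3 * (K + 1)))]
    have hqt : (q : ℝ) - t ≤ ε / (3 * (K + 1)) := by
      linarith [min_le_right 1 (ε / (3 * (K + 1)))]
    -- the equi-Lipschitz bound transfers convergence at `q` to the Cauchy property at `t`
    have hnear : ∀ n, dist (y (φ n) t) (y (φ n) q) < ε / 3 := by
      intro n
      have h1 := (hΛ T (φ n)).dist_le_mul t ⟨ht, by linarith⟩ q ⟨hq0, hqT⟩
      rw [Real.dist_eq, abs_sub_comm, abs_of_nonneg (by linarith : (0 : ℝ) ≤ q - t)] at h1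
      calc _ ≤ K * (q - t) := h1
        _ ≤ K * (ε / (3 * (K + 1))) := by gcongr
        _ < (K + 1) * (ε / (3 * (K + 1))) := by gcongr; linarith
        _ = ε / 3 := by field
    have hc := (hZ q).cauchySeq
    rw [Metric.cauchySeq_iff] at hc
    obtain ⟨N, hN⟩ := hc (ε / 3) (by positivity)
    refine ⟨N, fun m hm n hn => ?_⟩
    have h2 := hN m hm n hn
    simp only [Function.comp_apply, Y, abs_of_nonneg hq0] at h2
    have h3 := dist_triangle4 (y (φ m) t) (y (φ m) q) (y (φ n) q) (y (φ n) t)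
    have h4 := hnear m
    have h5 := hnear n
    rw [dist_comm] at h5
    linarith
  choose! z hz using hlim
  exact ⟨φ, hφ, z, hz⟩

variable [NormedSpace ℝ E]

theorem lipschitzOnWith_integral_of_bounded {g : ℝ → E} {T C : ℝ} (hT : 0 ≤ T)
    (hg : AEStronglyMeasurable g (volume.restrict (Ioc 0 T)))
    (hC : ∀ᵐ s ∂volume.restrict (Ioc 0 T), ‖g s‖ ≤ C) :
    LipschitzOnWith C.toNNReal (fun t => ∫ s in (0 : ℝ)..t, g s) (Icc 0 T) := by
  have hint := intervalIntegrable_of_ae_norm_le hT hg hC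
  have hsub : ∀ s ∈ Icc 0 T, IntervalIntegrable g volume 0 s := fun s hs =>
    hint.mono_set (by rw [uIcc_of_le hs.1, uIcc_of_le hT]; exact Icc_subset_Icc_right hs.2)
  refine LipschitzOnWith.of_dist_le_mul fun s hs t ht => ?_
  rw [dist_eq_norm, intervalIntegral.integral_interval_sub_left (hsub s hs) (hsub t ht),
    Real.dist_eq]
  refine intervalIntegral.norm_integral_le_of_norm_le_const_ae ?_
  rw [ae_restrict_iff' measurableSet_Ioc] at hC
  filter_upwards [hC] with r hr hrm
  refine (hr ?_).trans (Real.le_coe_toNNReal C)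
  rw [mem_uIoc] at hrm
  rcases hrm with h | h
  · exact ⟨ht.1.trans_lt h.1, h.2.trans hs.2⟩
  · exact ⟨hs.1.trans_lt h.1, h.2.trans ht.2⟩

theorem absolutelyContinuousOnInterval_integral_of_bounded {g : ℝ → E} {T C : ℝ} (hT : 0 ≤ T)
    (hg : AEStronglyMeasurable g (volume.restrict (Ioc 0 T)))
    (hC : ∀ᵐ s ∂volume.restrict (Ioc 0 T), ‖g s‖ ≤ C) :
    AbsolutelyContinuousOnInterval (fun t => ∫ s in (0 : ℝ)..t, g s) 0 T :=
  LipschitzOnWith.absolutelyContinuousOnInterval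
    (by rw [uIcc_of_le hT]; exact lipschitzOnWith_integral_of_bounded hT hg hC)

variable [CompleteSpace E]

/-- The fundamental theorem of calculus for absolutely continuous functions with bounded
derivative, with values in a Banach space. -/
theorem integral_eq_sub_of_absolutelyContinuousOnInterval {y g : ℝ → E} {T C : ℝ} (hT : 0 ≤ T)
    (hy : AbsolutelyContinuousOnInterval y 0 T)
    (hg : AEStronglyMeasurable g (volume.restrict (Ioc 0 T)))
    (hC : ∀ᵐ s ∂volume.restrict (Ioc 0 T), ‖g s‖ ≤ C)
    (hyg : ∀ᵐ s ∂volume.restrict (Ioc 0 T), HasDerivAt y (g s) s) :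
    ∫ s in (0 : ℝ)..T, g s = y T - y 0 := by
  have hint := intervalIntegrable_of_ae_norm_le hT hg hC
  have hac := hy.fun_sub (absolutelyContinuousOnInterval_integral_of_bounded hT hg hC)
  rw [ae_restrict_iff' measurableSet_Ioc] at hyg
  obtain ⟨z, hz⟩ := hac.const_of_ae_hasDerivAt_zero (by
    have h0 : ∀ᵐ s : ℝ, s ≠ 0 := by simp [ae_iff, measure_singleton]
    filter_upwards [hyg, hint.ae_hasDerivAt_integral, h0] with s h1 h2 h3 hs
    have hs' : s ∈ Ioc 0 T := by
      rw [uIcc_of_le hT] at hs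
      exact ⟨lt_of_le_of_ne hs.1 (Ne.symm h3), hs.2⟩
    simpa using (h1 hs').fun_sub (h2 hs 0 (by simp)))
  have h1 := hz 0 (by simp)
  have h2 := hz T (by simp)
  simp only [intervalIntegral.integral_same, sub_zero] at h1
  rw [← h1] at h2
  rw [← h2]
  abel

/-- Grönwall's inequality in integral form. -/
theorem le_gronwallBound_of_le_add_integral {φ : ℝ → ℝ} {δ M L T : ℝ} (hL : 0 ≤ L)
    (hφ : Continuous φ) (h : ∀ t ∈ Icc 0 T, φ t ≤ δ + ∫ s in (0 : ℝ)..t, (M + L * φ s)) :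
    ∀ t ∈ Icc 0 T, φ t ≤ gronwallBound δ L M t := by
  intro t ht
  have hc : Continuous fun s => M + L * φ s := by fun_prop
  have hd : ∀ t, HasDerivAt (fun t => δ + ∫ s in (0 : ℝ)..t, (M + L * φ s)) (M + L * φ t) t :=
    fun t => (hc.integral_hasStrictDerivAt 0 t).hasDerivAt.const_add δ
  have := le_gronwallBound_of_liminf_deriv_right_le (δ := δ) (K := L) (ε := M) (a := 0) (b := T)
    (f := fun t => δ + ∫ s in (0 : ℝ)..t, (M + L * φ s)) (f' := fun t => M + L * φ t)
    (fun t _ => (hd t).continuousAt.continuousWithinAt)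
    (fun t _ r hr => (hd t).hasDerivWithinAt.liminf_right_slope_le hr)
    (by simp) (fun t ht => by
      have := mul_le_mul_of_nonneg_left (h t ⟨ht.1, ht.2.le⟩) hL
      linarith) t ht
  exact (h t ht).trans (by simpa using this)

end

/-! ### Trajectories and the epigraph of the velocity set -/

variable {d m : ℕ} {U : Set (Vec m)} {f : Vec d → Vec m → Vec d} {x : Vec d}

theorem IsTrajectory.continuousOn {u : ℝ → Vec m} {y : ℝ → Vec d} (h : IsTrajectory f x u y) :
    ContinuousOn y (Ici 0) := by
  refine continuousOn_of_locally_continuousOn fun t ht => ⟨Iio (t + 1), isOpen_Iio, by simp, ?_⟩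
  have ht' : (0 : ℝ) < t + 1 := by linarith [mem_Ici.1 ht]
  have := (h.1 (t + 1) ht').continuousOn
  rw [uIcc_of_le ht'.le] at this
  exact this.mono fun s hs => ⟨hs.1, le_of_lt hs.2⟩

theorem ae_restrict_Ioc_of_Ioi {p : ℝ → Prop} (h : ∀ᵐ s ∂volume.restrict (Ioi (0 : ℝ)), p s)
    (T : ℝ) : ∀ᵐ s ∂volume.restrict (Ioc 0 T), p s :=
  ae_restrict_of_ae_restrict_of_subset Ioc_subset_Ioi_self h

theorem IsAdmissible.ae_hasDerivAt_deriv {u : ℝ → Vec m} {y : ℝ → Vec d}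
    (h : IsAdmissible U f x y u) :
    ∀ᵐ s ∂volume.restrict (Ioi (0 : ℝ)), u s ∈ U ∧ deriv y s = f (y s) (u s) ∧
      HasDerivAt y (deriv y s) s := by
  filter_upwards [h.1.2, h.2.2.1] with s h1 h2
  exact ⟨h1, h2.deriv, h2.deriv ▸ h2⟩

/-- Linear growth of the dynamics, uniformly in the control. -/
theorem exists_linear_growth (hU : IsCompact U)
    (hf : ContinuousOn (fun q : Vec d × Vec m => f q.1 q.2) (univ ×ˢ U)) {L : ℝ}
    (hL : ∀ u ∈ U, ∀ x₁ x₂ : Vec d, ‖f x₁ u - f x₂ u‖ ≤ L * ‖x₁ - x₂‖) :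
    ∃ M : ℝ, ∀ u ∈ U, ∀ x, ‖f x u‖ ≤ M + L * ‖x‖ := by
  obtain ⟨M, hM⟩ := hU.exists_bound_of_continuousOn (f := fun u => f 0 u)
    (hf.comp (Continuous.prodMk_right (0 : Vec d)).continuousOn fun u hu => ⟨mem_univ _, hu⟩)
  refine ⟨M, fun u hu x => ?_⟩
  have h1 := hL u hu x 0
  have h2 := hM u hu
  have h3 := norm_add_le (f x u - f 0 u) (f 0 u)
  simp only [sub_zero, sub_add_cancel] at h1 h3
  linarith

theorem IsAdmissible.integral_deriv_eq {u : ℝ → Vec m} {y : ℝ → Vec d}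
    (h : IsAdmissible U f x y u) {T C : ℝ} (hT : 0 ≤ T)
    (hC : ∀ᵐ s ∂volume.restrict (Ioc 0 T), ‖deriv y s‖ ≤ C) :
    ∫ s in (0 : ℝ)..T, deriv y s = y T - x := by
  have hac : AbsolutelyContinuousOnInterval y 0 T :=
    (h.2.1 (T + 1) (by linarith)).mono (by
      rw [uIcc_of_le hT, uIcc_of_le (by linarith : (0 : ℝ) ≤ T + 1)]
      exact Icc_subset_Icc_right (by linarith))
  rw [integral_eq_sub_of_absolutelyContinuousOnInterval hT hac
    (stronglyMeasurable_deriv y).aestronglyMeasurable hC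
    ((ae_restrict_Ioc_of_Ioi h.ae_hasDerivAt_deriv T).mono fun s hs => hs.2.2), h.2.2.2]

/-- All trajectories with a given initial value satisfy the same bound on a bounded interval. -/
theorem exists_uniform_bound {L M : ℝ} (hL : 0 < L)
    (hM : ∀ u ∈ U, ∀ x, ‖f x u‖ ≤ M + L * ‖x‖) (T : ℝ) :
    ∃ C : ℝ, ∀ y u, IsAdmissible U f x y u → ∀ t ∈ Icc 0 T, ‖y t‖ ≤ C := by
  have hcont : Continuous (gronwallBound ‖x‖ L M) :=
    continuous_iff_continuousAt.2 fun t => (hasDerivAt_gronwallBound _ _ _ t).continuousAt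
  obtain ⟨C, hC⟩ := (isCompact_Icc (a := (0 : ℝ)) (b := T)).exists_bound_of_continuousOn
    hcont.continuousOn
  refine ⟨C, fun y u h t ht => ?_⟩
  refine le_trans ?_ ((le_abs_self _).trans (hC t ht))
  -- extended by its initial value to the left of the origin, the trajectory is continuous on `ℝ`
  have hc : Continuous fun s => y (max s 0) :=
    h.2.continuousOn.comp_continuous (by fun_prop) fun s => le_max_right s 0
  have key := le_gronwallBound_of_le_add_integral (φ := fun s => ‖y (max s 0)‖) (δ := ‖x‖)
    (M := M) (T := T) hL.le hc.norm ?_ t ht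
  · simpa [max_eq_left ht.1] using key
  intro s hs
  obtain ⟨B, hB⟩ := (isCompact_Icc (a := (0 : ℝ)) (b := s)).exists_bound_of_continuousOn
    (h.2.continuousOn.mono Icc_subset_Ici_self)
  have hder : ∀ᵐ r ∂volume.restrict (Ioc 0 s), ‖deriv y r‖ ≤ M + L * ‖y (max r 0)‖ := by
    filter_upwards [ae_restrict_Ioc_of_Ioi h.ae_hasDerivAt_deriv s,
      ae_restrict_mem measurableSet_Ioc] with r hr hr'
    rw [max_eq_left hr'.1.le, hr.2.1]
    exact hM _ hr.1 _
  have hderB : ∀ᵐ r ∂volume.restrict (Ioc 0 s), ‖deriv y r‖ ≤ M + L * B := by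
    filter_upwards [hder, ae_restrict_mem measurableSet_Ioc] with r hr hr'
    rw [max_eq_left hr'.1.le] at hr
    exact hr.trans (by have := hB r ⟨hr'.1.le, hr'.2⟩; gcongr)
  have hint := h.integral_deriv_eq hs.1 hderB
  have h1 : ‖∫ r in (0 : ℝ)..s, deriv y r‖ ≤ ∫ r in (0 : ℝ)..s, (M + L * ‖y (max r 0)‖) := by
    refine intervalIntegral.norm_integral_le_of_norm_le hs.1 ?_
      ((continuous_const.add (continuous_const.mul hc.norm)).intervalIntegrable _ _)
    exact (ae_restrict_iff' measurableSet_Ioc).1 hder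
  rw [hint] at h1
  simp only [max_eq_left hs.1]
  have := norm_sub_norm_le (y s) x
  linarith

theorem exists_uniform_deriv_bound {L M : ℝ} (hL : 0 < L)
    (hM : ∀ u ∈ U, ∀ x, ‖f x u‖ ≤ M + L * ‖x‖) (T : ℝ) :
    ∃ C : ℝ, ∀ y u, IsAdmissible U f x y u →
      ∀ᵐ s ∂volume.restrict (Ioc 0 T), ‖deriv y s‖ ≤ C := by
  obtain ⟨C, hC⟩ := exists_uniform_bound (x := x) hL hM T
  refine ⟨M + L * C, fun y u h => ?_⟩
  filter_upwards [ae_restrict_Ioc_of_Ioi h.ae_hasDerivAt_deriv T,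
    ae_restrict_mem measurableSet_Ioc] with r hr hr'
  rw [hr.2.1]
  refine (hM _ hr.1 _).trans ?_
  have := hC y u h r ⟨hr'.1.le, hr'.2⟩
  gcongr

theorem IsAdmissible.lipschitzOnWith {u : ℝ → Vec m} {y : ℝ → Vec d}
    (h : IsAdmissible U f x y u) {T C : ℝ} (hT : 0 ≤ T)
    (hC : ∀ᵐ s ∂volume.restrict (Ioc 0 T), ‖deriv y s‖ ≤ C) :
    LipschitzOnWith C.toNNReal y (Icc 0 T) := by
  have h1 := lipschitzOnWith_integral_of_bounded hT
    (stronglyMeasurable_deriv y).aestronglyMeasurable hC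
  have heq : ∀ t ∈ Icc 0 T, ∫ s in (0 : ℝ)..t, deriv y s = y t - x := fun t ht =>
    h.integral_deriv_eq ht.1
      (ae_restrict_of_ae_restrict_of_subset (Ioc_subset_Ioc_right ht.2) hC)
  intro s hs t ht
  have := h1 hs ht
  simpa [heq s hs, heq t ht] using this

theorem continuous_runningCost {γ : ℝ} {ℓ₁ : Vec d → ℝ} (hℓ : Continuous ℓ₁) :
    Continuous fun q : Vec d × Vec m => runningCost γ ℓ₁ q.1 q.2 := by
  unfold runningCost
  fun_prop

theorem runningCost_nonneg {γ : ℝ} (hγ : 0 ≤ γ) {ℓ₁ : Vec d → ℝ} (hℓ : ∀ x, 0 ≤ ℓ₁ x)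
    (x : Vec d) (u : Vec m) : 0 ≤ runningCost γ ℓ₁ x u :=
  add_nonneg (hℓ x) (mul_nonneg hγ (Finset.sum_nonneg fun _ _ => abs_nonneg _))

theorem exists_uniform_cost_bound {L M : ℝ} (hL : 0 < L)
    (hM : ∀ u ∈ U, ∀ x, ‖f x u‖ ≤ M + L * ‖x‖) (hU : IsCompact U) (γ : ℝ) {ℓ₁ : Vec d → ℝ}
    (hℓ : Continuous ℓ₁) (T : ℝ) :
    ∃ C : ℝ, ∀ y u, IsAdmissible U f x y u →
      ∀ᵐ s ∂volume.restrict (Ioc 0 T), ‖runningCost γ ℓ₁ (y s) (u s)‖ ≤ C := by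
  obtain ⟨R, hR⟩ := exists_uniform_bound (x := x) hL hM T
  obtain ⟨C, hC⟩ := ((isCompact_closedBall (0 : Vec d) R).prod hU).exists_bound_of_continuousOn
    (continuous_runningCost (γ := γ) hℓ).continuousOn
  refine ⟨C, fun y u h => ?_⟩
  filter_upwards [ae_restrict_Ioc_of_Ioi h.1.2 T, ae_restrict_mem measurableSet_Ioc] with s h1 h2
  exact hC (y s, u s) ⟨by simpa using hR y u h s ⟨h2.1.le, h2.2⟩, h1⟩

/-- The points `((x, v, ξ), u)` for which the control `u` at the state `x` produces the velocity
`v` at a running cost not above `ξ`. -/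
def velocityCostRel (U : Set (Vec m)) (f : Vec d → Vec m → Vec d) (ℓ : Vec d → Vec m → ℝ) :
    Set ((Vec d × Vec d × ℝ) × U) :=
  {q | f q.1.1 q.2 = q.1.2.1 ∧ ℓ q.1.1 q.2 ≤ q.1.2.2}

theorem isClosed_velocityCostRel
    (hf : ContinuousOn (fun q : Vec d × Vec m => f q.1 q.2) (univ ×ˢ U))
    {ℓ : Vec d → Vec m → ℝ} (hℓ : Continuous fun q : Vec d × Vec m => ℓ q.1 q.2) :
    IsClosed (velocityCostRel U f ℓ) := by
  have hf' : Continuous fun q : (Vec d × Vec d × ℝ) × U => f q.1.1 q.2 :=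
    hf.comp_continuous (f := fun q : (Vec d × Vec d × ℝ) × U => (q.1.1, (q.2 : Vec m)))
      (by fun_prop) fun q => ⟨mem_univ _, q.2.2⟩
  have hℓ' : Continuous fun q : (Vec d × Vec d × ℝ) × U => ℓ q.1.1 q.2 :=
    hℓ.comp (g := fun q : Vec d × Vec m => ℓ q.1 q.2)
      (f := fun q : (Vec d × Vec d × ℝ) × U => (q.1.1, (q.2 : Vec m))) (by fun_prop)
  exact (isClosed_eq hf' (by fun_prop)).inter (isClosed_le hℓ' (by fun_prop))

/-- Limits of convex combinations of velocities and costs attained along states tending to `x` are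
attained at `x` by a single control, up to a decrease of the cost. -/
theorem exists_control_of_tendsto (hU : IsCompact U)
    (hf : ContinuousOn (fun q : Vec d × Vec m => f q.1 q.2) (univ ×ˢ U)) {L : ℝ}
    (hL : ∀ u ∈ U, ∀ x₁ x₂ : Vec d, ‖f x₁ u - f x₂ u‖ ≤ L * ‖x₁ - x₂‖)
    {γ : ℝ} {ℓ₁ : Vec d → ℝ} (hℓ : Continuous ℓ₁)
    (hconv : Convex ℝ {q : Vec d × ℝ | ∃ u ∈ U, q.1 = f x u ∧ runningCost γ ℓ₁ x u ≤ q.2})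
    {c : ℕ → ℕ →₀ ℝ} (hc : IsForwardConvex c) {a : ℕ → Vec d} {w : ℕ → Vec m}
    (hw : ∀ k, w k ∈ U) (ha : Tendsto a atTop (𝓝 x)) {v : Vec d} {ξ : ℝ}
    (hv : Tendsto (fun n => ∑ k ∈ (c n).support, c n k • f (a k) (w k)) atTop (𝓝 v))
    (hξ : Tendsto (fun n => ∑ k ∈ (c n).support, c n k • runningCost γ ℓ₁ (a k) (w k)) atTop
      (𝓝 ξ)) :
    ∃ u : U, ((x, v, ξ), u) ∈ velocityCostRel U f (runningCost γ ℓ₁) := by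
  have : CompactSpace U := isCompact_iff_compactSpace.1 hU
  have hcl := isClosedMap_fst_of_compactSpace (X := Vec d × Vec d × ℝ) (Y := U) _
    (isClosed_velocityCostRel hf (continuous_runningCost (γ := γ) hℓ))
  -- freezing the state at its limit changes neither limit
  have h1 : Tendsto (fun k => f x (w k) - f (a k) (w k)) atTop (𝓝 0) := by
    refine squeeze_zero_norm (fun k => hL _ (hw k) _ _) ?_
    simpa using ((tendsto_const_nhds (x := x)).sub ha).norm.const_mul L
  have h2 : Tendsto (fun k => runningCost γ ℓ₁ x (w k) - runningCost γ ℓ₁ (a k) (w k)) atTop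
      (𝓝 0) := by
    simpa [runningCost] using (tendsto_const_nhds (x := ℓ₁ x)).sub ((hℓ.tendsto x).comp ha)
  have hv' := hv.add (hc.tendsto_sum h1)
  have hξ' := hξ.add (hc.tendsto_sum h2)
  simp only [← Finset.sum_add_distrib, ← smul_add, add_sub_cancel, add_zero] at hv' hξ'
  have hmem := hcl.mem_of_tendsto ((tendsto_const_nhds (x := x)).prodMk_nhds (hv'.prodMk_nhds hξ'))
    (Eventually.of_forall fun n => by
      obtain ⟨c0, c1, -⟩ := hc n
      obtain ⟨u, hu, hu1, hu2⟩ := hconv.sum_mem (fun k _ => c0 k) c1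
        (z := fun k => (f x (w k), runningCost γ ℓ₁ x (w k)))
        (fun k _ => ⟨w k, hw k, rfl, le_rfl⟩)
      refine ⟨(_, ⟨u, hu⟩), ⟨?_, ?_⟩, rfl⟩
      · simpa [Prod.fst_sum] using hu1.symm
      · simpa [Prod.snd_sum] using hu2)
  obtain ⟨⟨p, u⟩, hpu, hp⟩ := hmem
  exact ⟨u, by rw [← hp]; exact hpu⟩

/-! ### Lower closure -/

theorem ae_restrict_Ioi_of_forall_Ioc {p : ℝ → Prop}
    (h : ∀ N : ℕ, ∀ᵐ s ∂volume.restrict (Ioc (0 : ℝ) N), p s) :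
    ∀ᵐ s ∂volume.restrict (Ioi (0 : ℝ)), p s := by
  rw [ae_restrict_iff' measurableSet_Ioi]
  filter_upwards [ae_all_iff.2 fun N => (ae_restrict_iff' measurableSet_Ioc).1 (h N)] with s hs hs0
  obtain ⟨N, hN⟩ := exists_nat_ge s
  exact hs N ⟨hs0, hN⟩

/-- Functions with common bounds on bounded intervals have a common measurable pointwise
bound, constant between consecutive integers. -/
theorem exists_measurable_bound {F : Type*} [NormedAddCommGroup F] {h : ℕ → ℝ → F}
    (hb : ∀ N : ℕ, ∃ C : ℝ, ∀ k, ∀ᵐ s ∂volume.restrict (Ioc (0 : ℝ) N), ‖h k s‖ ≤ C) :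
    ∃ G : ℝ → ℝ, Measurable G ∧ (∀ s, 0 < G s) ∧
      ∀ k, ∀ᵐ s ∂volume.restrict (Ioi (0 : ℝ)), ‖h k s‖ ≤ G s := by
  choose C hC using hb
  refine ⟨fun s => max (C ⌈s⌉₊) 1,
    (measurable_from_nat (f := fun n => max (C n) 1)).comp Nat.measurable_ceil,
    fun s => lt_max_of_lt_right one_pos, fun k => ?_⟩
  rw [ae_restrict_iff' measurableSet_Ioi]
  filter_upwards [ae_all_iff.2 fun N => (ae_restrict_iff' measurableSet_Ioc).1 (hC N k)]
    with s hs hs0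
  exact (hs ⌈s⌉₊ ⟨hs0, Nat.le_ceil s⟩).trans (le_max_left _ _)

theorem IsForwardConvex.norm_sum_le {E : Type*} [NormedAddCommGroup E] [NormedSpace ℝ E]
    {c : ℕ → ℕ →₀ ℝ} (hc : IsForwardConvex c) {a : ℕ → E} {C : ℝ} (ha : ∀ k, ‖a k‖ ≤ C) (n : ℕ) :
    ‖∑ k ∈ (c n).support, c n k • a k‖ ≤ C := by
  have := (convex_closedBall (0 : E) C).sum_mem (fun k _ => (hc n).1 k) (hc n).2.1
    (z := a) (fun k _ => by simpa using ha k)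
  simpa using this

/-- If forward convex combinations of uniformly bounded functions `g k` converge to `v`, and the
integrals of the `g k` converge to `z`, then `v` has the integral `z`. -/
theorem IsForwardConvex.integral_eq_of_tendsto {E : Type*} [NormedAddCommGroup E]
    [NormedSpace ℝ E] [CompleteSpace E] {c : ℕ → ℕ →₀ ℝ} (hc : IsForwardConvex c)
    {g : ℕ → ℝ → E} {v : ℝ → E} {T C : ℝ} (hT : 0 ≤ T)
    (hg : ∀ k, AEStronglyMeasurable (g k) (volume.restrict (Ioc 0 T)))
    (hC : ∀ k, ∀ᵐ s ∂volume.restrict (Ioc 0 T), ‖g k s‖ ≤ C)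
    (hv : ∀ᵐ s ∂volume.restrict (Ioc 0 T),
      Tendsto (fun n => ∑ k ∈ (c n).support, c n k • g k s) atTop (𝓝 (v s)))
    {z : E} (hz : Tendsto (fun k => ∫ s in (0 : ℝ)..T, g k s) atTop (𝓝 z)) :
    ∫ s in (0 : ℝ)..T, v s = z := by
  refine tendsto_nhds_unique ?_ (hc.tendsto_sum hz)
  have hint : ∀ k, IntervalIntegrable (g k) volume 0 T := fun k =>
    intervalIntegrable_of_ae_norm_le hT (hg k) (hC k)
  have heq : ∀ n, ∑ k ∈ (c n).support, c n k • ∫ s in (0 : ℝ)..T, g k s =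
      ∫ s in (0 : ℝ)..T, ∑ k ∈ (c n).support, c n k • g k s := by
    intro n
    rw [intervalIntegral.integral_finsetSum (f := fun k s => c n k • g k s)
      fun k _ => (hint k).smul (c n k)]
    simp
  simp_rw [heq]
  rw [← ae_all_iff] at hC
  rw [ae_restrict_iff' measurableSet_Ioc] at hC hv
  refine intervalIntegral.tendsto_integral_filter_of_dominated_convergence (fun _ => C)
    (Eventually.of_forall fun n => ?_) (Eventually.of_forall fun n => ?_) (by simp) ?_
  · rw [uIoc_of_le hT]
    exact Finset.aestronglyMeasurable_fun_sum _ fun k _ => (hg k).const_smul (c n k)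
  · rw [uIoc_of_le hT]
    filter_upwards [hC] with s hs hs'
    exact hc.norm_sum_le (fun k => hs hs' k) n
  · rw [uIoc_of_le hT]
    exact hv

/-- Fatou's lemma for forward convex combinations. -/
theorem IsForwardConvex.lintegral_ofReal_le {Ω : Type*} [MeasurableSpace Ω] {μ : Measure Ω}
    {c : ℕ → ℕ →₀ ℝ} (hc : IsForwardConvex c) {g : ℕ → Ω → ℝ} {ζ : Ω → ℝ}
    (hg : ∀ k, AEMeasurable (g k) μ) (hg0 : ∀ k ω, 0 ≤ g k ω)
    (hζ : ∀ᵐ ω ∂μ, Tendsto (fun n => ∑ k ∈ (c n).support, c n k • g k ω) atTop (𝓝 (ζ ω)))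
    {J : ENNReal} (hJ : Tendsto (fun k => ∫⁻ ω, ENNReal.ofReal (g k ω) ∂μ) atTop (𝓝 J)) :
    ∫⁻ ω, ENNReal.ofReal (ζ ω) ∂μ ≤ J := by
  refine le_of_forall_gt_imp_ge_of_dense fun a ha => ?_
  obtain ⟨N, hN⟩ := eventually_atTop.1 (hJ.eventually_le_const ha)
  have hle : ∀ n, N ≤ n →
      ∫⁻ ω, ENNReal.ofReal (∑ k ∈ (c n).support, c n k • g k ω) ∂μ ≤ a := by
    intro n hn
    obtain ⟨h0, h1, h2⟩ := hc n
    calc ∫⁻ ω, ENNReal.ofReal (∑ k ∈ (c n).support, c n k • g k ω) ∂μ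
        = ∫⁻ ω, ∑ k ∈ (c n).support, ENNReal.ofReal (c n k) * ENNReal.ofReal (g k ω) ∂μ := by
          refine lintegral_congr fun ω => ?_
          rw [ENNReal.ofReal_sum_of_nonneg fun k _ => smul_nonneg (h0 k) (hg0 k ω)]
          simp only [smul_eq_mul, ENNReal.ofReal_mul (h0 _)]
      _ = ∑ k ∈ (c n).support, ENNReal.ofReal (c n k) * ∫⁻ ω, ENNReal.ofReal (g k ω) ∂μ := by
          rw [lintegral_finsetSum' _ fun k _ => (hg k).ennreal_ofReal.const_mul _]
          exact Finset.sum_congr rfl fun k _ => lintegral_const_mul' _ _ ENNReal.ofReal_ne_top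
      _ ≤ ∑ k ∈ (c n).support, ENNReal.ofReal (c n k) * a :=
          Finset.sum_le_sum fun k hk => by gcongr; exact hN k (hn.trans (h2 k hk))
      _ = a := by
          rw [← Finset.sum_mul, ← ENNReal.ofReal_sum_of_nonneg fun k _ => h0 k, h1]
          simp
  calc ∫⁻ ω, ENNReal.ofReal (ζ ω) ∂μ
      = ∫⁻ ω, liminf (fun n => ENNReal.ofReal (∑ k ∈ (c n).support, c n k • g k ω)) atTop ∂μ := by
        refine lintegral_congr_ae ?_
        filter_upwards [hζ] with ω hω
        exact ((ENNReal.continuous_ofReal.tendsto _).comp hω).liminf_eq.symm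
    _ ≤ liminf (fun n => ∫⁻ ω, ENNReal.ofReal (∑ k ∈ (c n).support, c n k • g k ω) ∂μ) atTop :=
        lintegral_liminf_le' fun n => (Finset.aemeasurable_fun_sum _ fun k _ =>
          (hg k).const_smul (c n k)).ennreal_ofReal
    _ ≤ a := by
        refine liminf_le_of_frequently_le' (Eventually.frequently ?_)
        filter_upwards [eventually_ge_atTop N] with n hn using hle n hn

theorem IsTrajectory.aemeasurable {u : ℝ → Vec m} {y : ℝ → Vec d} (h : IsTrajectory f x u y) :
    AEMeasurable y (volume.restrict (Ioi 0)) :=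
  (h.continuousOn.mono Ioi_subset_Ici_self).aemeasurable measurableSet_Ioi

theorem IsAdmissible.aemeasurable_runningCost {u : ℝ → Vec m} {y : ℝ → Vec d}
    (h : IsAdmissible U f x y u) {γ : ℝ} {ℓ₁ : Vec d → ℝ} (hℓ : Continuous ℓ₁) :
    AEMeasurable (fun s => runningCost γ ℓ₁ (y s) (u s)) (volume.restrict (Ioi 0)) :=
  (continuous_runningCost hℓ).measurable.comp_aemeasurable
    (h.2.aemeasurable.prodMk h.1.1.aestronglyMeasurable.aemeasurable)

/-- If, almost everywhere along the primitive `z` of a locally bounded function `v`, some control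
produces the velocity `v` at a running cost at most `ξ`, then a measurable control does so. The
trajectory is extended to negative times by the same primitive, as `z` is arbitrary there. -/
theorem exists_isAdmissible_of_velocityCostRel (hU : IsCompact U)
    (hf : ContinuousOn (fun q : Vec d × Vec m => f q.1 q.2) (univ ×ˢ U))
    {ℓ : Vec d → Vec m → ℝ} (hℓ : Continuous fun q : Vec d × Vec m => ℓ q.1 q.2)
    {v : ℝ → Vec d} {ξ : ℝ → ℝ} (hv : Measurable v) (hξ : Measurable ξ)
    (hb : ∀ N : ℕ, ∃ C : ℝ, ∀ᵐ s ∂volume.restrict (Ioc (0 : ℝ) N), ‖v s‖ ≤ C)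
    {z : ℝ → Vec d} (hz : ∀ t, 0 ≤ t → z t = x + ∫ s in (0 : ℝ)..t, v s)
    (hrel : ∀ᵐ s ∂volume.restrict (Ioi (0 : ℝ)),
      ∃ w : U, ((z s, v s, ξ s), w) ∈ velocityCostRel U f ℓ) :
    ∃ y u, IsAdmissible U f x y u ∧
      ∀ᵐ s ∂volume.restrict (Ioi (0 : ℝ)), ℓ (y s) (u s) ≤ ξ s := by
  have : CompactSpace U := isCompact_iff_compactSpace.1 hU
  have : Nonempty U := by
    have : (ae (volume.restrict (Ioi (0 : ℝ)))).NeBot := by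
      rw [ae_neBot]
      intro h
      simpa using congrArg (fun μ => μ univ) h
    obtain ⟨s, w, -⟩ := hrel.exists
    exact ⟨w⟩
  obtain ⟨σ, hσ, hσF⟩ := exists_measurable_selection (isClosed_velocityCostRel hf hℓ)
  choose C hC using hb
  let y : ℝ → Vec d := fun t => x + ∫ s in (0 : ℝ)..t, v s
  have hac : ∀ N : ℕ, AbsolutelyContinuousOnInterval y 0 N := fun N =>
    (LipschitzWith.const x).lipschitzOnWith.absolutelyContinuousOnInterval.fun_add
      (absolutelyContinuousOnInterval_integral_of_bounded N.cast_nonneg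
        hv.aestronglyMeasurable (hC N))
  have hacT : ∀ T : ℝ, 0 < T → AbsolutelyContinuousOnInterval y 0 T := by
    intro T hT
    obtain ⟨N, hN⟩ := exists_nat_ge T
    refine (hac N).mono ?_
    rw [uIcc_of_le hT.le, uIcc_of_le N.cast_nonneg]
    exact Icc_subset_Icc_right hN
  have hder : ∀ᵐ s ∂volume.restrict (Ioi (0 : ℝ)), HasDerivAt y (v s) s := by
    refine ae_restrict_Ioi_of_forall_Ioc fun N => ?_
    rw [ae_restrict_iff' measurableSet_Ioc]
    have hint := intervalIntegrable_of_ae_norm_le (N.cast_nonneg (α := ℝ))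
      hv.aestronglyMeasurable (hC N)
    filter_upwards [hint.ae_hasDerivAt_integral] with s hs hsN
    refine (hs ?_ 0 (by simp)).const_add x
    rw [uIcc_of_le N.cast_nonneg]
    exact Ioc_subset_Icc_self hsN
  let u : ℝ → Vec m := fun s => σ (y s, v s, ξ s)
  have hu : ∀ s, u s ∈ U := fun s => (σ _).2
  have hyu : ∀ᵐ s ∂volume.restrict (Ioi (0 : ℝ)), f (y s) (u s) = v s ∧ ℓ (y s) (u s) ≤ ξ s := by
    filter_upwards [hrel, ae_restrict_mem measurableSet_Ioi] with s hs hs0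
    rw [hz s (le_of_lt hs0)] at hs
    exact hσF _ hs
  have htraj : IsTrajectory f x u y := by
    refine ⟨hacT, ?_, by simp [y]⟩
    filter_upwards [hder, hyu] with s h1 h2
    rwa [h2.1]
  obtain ⟨B, hB⟩ := hU.exists_bound_of_continuousOn continuousOn_id
  -- only the measurability of `u` is left, by composition with the measurable selection
  refine ⟨y, u, ⟨⟨memLp_top_of_bound ?_ B (Eventually.of_forall fun s => hB _ (hu s)),
    Eventually.of_forall hu⟩, htraj⟩, hyu.mono fun s hs => hs.2⟩
  exact (measurable_subtype_coe.comp hσ |>.comp_aemeasurable (htraj.aemeasurable.prodMk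
    (hv.prodMk hξ).aemeasurable)).aestronglyMeasurable

/-- Lower closure: admissible pairs whose trajectories converge pointwise and whose costs converge
to `J` yield an admissible pair of cost at most `J`. -/
theorem exists_isAdmissible_cost_le_of_tendsto (hU : IsCompact U)
    (hf : ContinuousOn (fun q : Vec d × Vec m => f q.1 q.2) (univ ×ˢ U)) {L : ℝ} (hL0 : 0 < L)
    (hL : ∀ u ∈ U, ∀ x₁ x₂ : Vec d, ‖f x₁ u - f x₂ u‖ ≤ L * ‖x₁ - x₂‖)
    {lam γ : ℝ} {ℓ₁ : Vec d → ℝ} (hγ : 0 ≤ γ) (hℓ : Continuous ℓ₁) (hℓ0 : ∀ x, 0 ≤ ℓ₁ x)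
    (hconv : ∀ x, Convex ℝ
      {q : Vec d × ℝ | ∃ u ∈ U, q.1 = f x u ∧ runningCost γ ℓ₁ x u ≤ q.2})
    {y : ℕ → ℝ → Vec d} {u : ℕ → ℝ → Vec m} (hyu : ∀ k, IsAdmissible U f x (y k) (u k))
    {z : ℝ → Vec d} (hz : ∀ t, 0 ≤ t → Tendsto (fun k => y k t) atTop (𝓝 (z t)))
    {J : ENNReal}
    (hJ : Tendsto (fun k => discountedCost lam (runningCost γ ℓ₁) (y k) (u k)) atTop (𝓝 J)) :
    ∃ y' u', IsAdmissible U f x y' u' ∧ discountedCost lam (runningCost γ ℓ₁) y' u' ≤ J := by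
  obtain ⟨M, hM⟩ := exists_linear_growth hU hf hL
  choose D hD using exists_uniform_deriv_bound (x := x) hL0 hM
  choose R hR using exists_uniform_cost_bound (x := x) hL0 hM hU γ hℓ
  -- velocities and running costs as one function with values in a Hilbert space
  let h : ℕ → ℝ → WithLp 2 (Vec d × ℝ) := fun k s =>
    WithLp.toLp 2 (deriv (y k) s, runningCost γ ℓ₁ (y k s) (u k s))
  have hcost := fun k => (hyu k).aemeasurable_runningCost (γ := γ) hℓ
  have hm : ∀ k, AEStronglyMeasurable (h k) (volume.restrict (Ioi 0)) := fun k =>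
    (WithLp.prod_continuous_toLp 2 (Vec d) ℝ).comp_aestronglyMeasurable
      ((stronglyMeasurable_deriv (y k)).aestronglyMeasurable.prodMk
        (hcost k).aestronglyMeasurable)
  obtain ⟨G, hG, hG0, hhG⟩ := exists_measurable_bound (h := h) fun N => by
    refine ⟨D N + R N, fun k => ?_⟩
    filter_upwards [hD N _ _ (hyu k), hR N _ _ (hyu k)] with s h1 h2
    have h3 : h k s = WithLp.toLp 2 (deriv (y k) s, 0) +
        WithLp.toLp 2 (0, runningCost γ ℓ₁ (y k s) (u k s)) := by
      simp [h, ← WithLp.toLp_add]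
    rw [h3]
    refine (norm_add_le _ _).trans ?_
    simpa using add_le_add h1 h2
  obtain ⟨c, hc, g, hg, hcg⟩ := exists_isForwardConvex_ae_tendsto hm hG hG0 hhG
  let v : ℝ → Vec d := fun s => (g s).fst
  let ξ : ℝ → ℝ := fun s => (g s).snd
  have hvm : Measurable v :=
    ((WithLp.fstL 2 ℝ (Vec d) ℝ).continuous.comp_stronglyMeasurable hg).measurable
  have hξm : Measurable ξ :=
    ((WithLp.sndL 2 ℝ (Vec d) ℝ).continuous.comp_stronglyMeasurable hg).measurable
  have hv : ∀ᵐ s ∂volume.restrict (Ioi (0 : ℝ)),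
      Tendsto (fun n => ∑ k ∈ (c n).support, c n k • deriv (y k) s) atTop (𝓝 (v s)) := by
    filter_upwards [hcg] with s hs
    have := ((WithLp.fstL 2 ℝ (Vec d) ℝ).continuous.tendsto _).comp hs
    simpa [Function.comp_def, h] using this
  have hξ : ∀ᵐ s ∂volume.restrict (Ioi (0 : ℝ)),
      Tendsto (fun n => ∑ k ∈ (c n).support, c n k • runningCost γ ℓ₁ (y k s) (u k s)) atTop
        (𝓝 (ξ s)) := by
    filter_upwards [hcg] with s hs
    have := ((WithLp.sndL 2 ℝ (Vec d) ℝ).continuous.tendsto _).comp hs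
    simpa [Function.comp_def, h] using this
  have hzv : ∀ t, 0 ≤ t → z t = x + ∫ s in (0 : ℝ)..t, v s := by
    intro t ht
    rw [hc.integral_eq_of_tendsto ht (fun k => (stronglyMeasurable_deriv (y k)).aestronglyMeasurable)
      (fun k => hD t _ _ (hyu k)) (ae_restrict_Ioc_of_Ioi hv t) (z := z t - x)]
    · abel
    · simp_rw [fun k => (hyu k).integral_deriv_eq ht (hD t _ _ (hyu k))]
      exact (hz t ht).sub_const x
  have hrel : ∀ᵐ s ∂volume.restrict (Ioi (0 : ℝ)),
      ∃ w : U, ((z s, v s, ξ s), w) ∈ velocityCostRel U f (runningCost γ ℓ₁) := by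
    filter_upwards [hv, hξ, ae_all_iff.2 fun k => (hyu k).ae_hasDerivAt_deriv,
      ae_restrict_mem measurableSet_Ioi] with s h1 h2 h3 h4
    simp only [fun k => (h3 k).2.1] at h1
    exact exists_control_of_tendsto hU hf hL hℓ (hconv (z s)) hc (fun k => (h3 k).1)
      (hz s (le_of_lt h4)) h1 h2
  obtain ⟨y', u', hadm, hle⟩ := exists_isAdmissible_of_velocityCostRel hU hf
    (continuous_runningCost hℓ) hvm hξm (fun N => ⟨D N, by
      filter_upwards [ae_restrict_Ioc_of_Ioi hv N,
        ae_all_iff.2 fun k => hD N _ _ (hyu k)] with s h1 h2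
      exact le_of_tendsto h1.norm (Eventually.of_forall fun n => hc.norm_sum_le h2 n)⟩) hzv hrel
  refine ⟨y', u', hadm, ?_⟩
  calc discountedCost lam (runningCost γ ℓ₁) y' u'
      ≤ ∫⁻ s in Ioi (0 : ℝ), ENNReal.ofReal (Real.exp (-lam * s) * ξ s) := by
        refine lintegral_mono_ae ?_
        filter_upwards [hle] with s hs
        gcongr
    _ ≤ J := by
        refine hc.lintegral_ofReal_le (fun k => ?_) (fun k s => ?_) ?_ hJ
        · exact (Measurable.aemeasurable (by fun_prop)).mul (hcost k)
        · exact mul_nonneg (Real.exp_pos _).le (runningCost_nonneg hγ hℓ0 _ _)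
        · filter_upwards [hξ] with s hs
          simpa only [Finset.mul_sum, smul_eq_mul, mul_left_comm] using
            hs.const_mul (Real.exp (-lam * s))

/-- Lower closure without convergence of the trajectories, which holds for a subsequence. -/
theorem exists_isAdmissible_cost_le (hU : IsCompact U)
    (hf : ContinuousOn (fun q : Vec d × Vec m => f q.1 q.2) (univ ×ˢ U)) {L : ℝ} (hL0 : 0 < L)
    (hL : ∀ u ∈ U, ∀ x₁ x₂ : Vec d, ‖f x₁ u - f x₂ u‖ ≤ L * ‖x₁ - x₂‖)
    {lam γ : ℝ} {ℓ₁ : Vec d → ℝ} (hγ : 0 ≤ γ) (hℓ : Continuous ℓ₁) (hℓ0 : ∀ x, 0 ≤ ℓ₁ x)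
    (hconv : ∀ x, Convex ℝ
      {q : Vec d × ℝ | ∃ u ∈ U, q.1 = f x u ∧ runningCost γ ℓ₁ x u ≤ q.2})
    {y : ℕ → ℝ → Vec d} {u : ℕ → ℝ → Vec m} (hyu : ∀ k, IsAdmissible U f x (y k) (u k))
    {J : ENNReal}
    (hJ : Tendsto (fun k => discountedCost lam (runningCost γ ℓ₁) (y k) (u k)) atTop (𝓝 J)) :
    ∃ y' u', IsAdmissible U f x y' u' ∧ discountedCost lam (runningCost γ ℓ₁) y' u' ≤ J := by
  have : CompactSpace U := isCompact_iff_compactSpace.1 hU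
  obtain ⟨M, hM⟩ := exists_linear_growth hU hf hL
  choose D hD using exists_uniform_deriv_bound (x := x) hL0 hM
  choose R hR using exists_uniform_cost_bound (x := x) hL0 hM hU γ hℓ
  -- a pointwise convergent subsequence of the trajectories
  obtain ⟨φ, hφ, y', hy'⟩ := exists_subseq_tendsto_of_lipschitzOnWith
    (Λ := fun N : ℕ => (D N).toNNReal) (fun k => (hyu k).2.2.2)
    (fun N k => (hyu k).lipschitzOnWith N.cast_nonneg (hD N _ _ (hyu k)))
  replace hJ := hJ.comp hφ.tendsto_atTop
  exact exists_isAdmissible_cost_le_of_tendsto hU hf hL0 hL hγ hℓ hℓ0 hconv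
    (fun k => hyu (φ k)) hy' hJ

end SparseControl

theorem mainTheorem1 (d m : ℕ) (lam γ : ℝ) (hlam : 0 < lam) (hγ : 0 < γ)
    (U : Set (SparseControl.Vec m)) (hUconvex : Convex ℝ U) (hUcompact : IsCompact U)
    (f : SparseControl.Vec d → SparseControl.Vec m → SparseControl.Vec d)
    (hf : ContinuousOn (fun q : SparseControl.Vec d × SparseControl.Vec m => f q.1 q.2)
      (Set.univ ×ˢ U))
    (ℓ₁ : SparseControl.Vec d → ℝ) (hℓ₁_nonneg : ∀ x, 0 ≤ ℓ₁ x)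
    (hℓ₁_convex : StrictConvexOn ℝ Set.univ ℓ₁)
    (H1 : ∃ L : ℝ, 0 < L ∧ ∀ u ∈ U, ∀ x₁ x₂ : SparseControl.Vec d,
      ‖f x₁ u - f x₂ u‖ ≤ L * ‖x₁ - x₂‖)
    (H2 : ∀ x : SparseControl.Vec d, ∃ (y : ℝ → SparseControl.Vec d) (u : ℝ → SparseControl.Vec m),
      SparseControl.IsAdmissible U f x y u ∧
      SparseControl.discountedCost lam (SparseControl.runningCost γ ℓ₁) y u < ⊤)
    (H3 : ∀ x : SparseControl.Vec d, Convex ℝ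
      {q : SparseControl.Vec d × ℝ |
        ∃ u ∈ U, q.1 = f x u ∧ SparseControl.runningCost γ ℓ₁ x u ≤ q.2}) :
    ∀ x : SparseControl.Vec d, ∃ u : ℝ → SparseControl.Vec m,
      SparseControl.IsOptimalControl lam U f (SparseControl.runningCost γ ℓ₁) x u := by
  intro x
  obtain ⟨L, hL0, hL⟩ := H1
  have hℓ : Continuous ℓ₁ :=
    continuousOn_univ.1 (hℓ₁_convex.convexOn.continuousOn isOpen_univ)
  let S : Set ENNReal := {J | ∃ y u, SparseControl.IsAdmissible U f x y u ∧
    SparseControl.discountedCost lam (SparseControl.runningCost γ ℓ₁) y u = J}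
  have hS : S.Nonempty := by
    obtain ⟨y, u, h, -⟩ := H2 x
    exact ⟨_, y, u, h, rfl⟩
  obtain ⟨J, -, hJ, hJS⟩ := exists_seq_tendsto_sInf hS (OrderBot.bddBelow S)
  choose y u hyu hcost using hJS
  rw [← funext hcost] at hJ
  obtain ⟨y', u', hadm, hle⟩ := SparseControl.exists_isAdmissible_cost_le hUcompact hf hL0 hL
    hγ.le hℓ hℓ₁_nonneg H3 hyu hJ
  exact ⟨u', y', hadm, fun z w hzw => hle.trans (sInf_le ⟨z, w, hzw, rfl⟩)⟩
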